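/- Let $(M,\mathcal P)$ be a (Hausdorff) Poisson manifold of dimension $d=2n+k$ with Poisson bracket $\{\cdot,\cdot\}$, and let $f\star g=\sum_{r\ge 0}\hbar^r C_r(f,g)$ be a star-product on it: the $C_r$ are bidifferential operators on $C^\infty(M)$ (complex-valued smooth functions), $C_0(f,g)=fg$, $C_1(f,g)-C_1(g,f)=i\{f,g\}$, $\sum_{l=0}^r\bigl(C_l(C_{r-l}(f,g),h)-C_l(f,C_{r-l}(g,h))\bigr)=0$ for all $r$, and $C_r(f,1)=C_r(1,f)=0$ for $r\ge1$. Assume moreover the parity condition $$C_r(f,g)=(-1)^rC_r(g,f)\qquad (r\ge 0,\ f,g\in C^\infty(M)).$$ Let $x=(x^1,\dots,x^d)$ be smooth coordinates on an open domain of $M$, with image an open set $U\subset\mathbb R^d$, which are both classical canonical, $\{x^\mu,x^\nu\}=\mathcal P^{\mu\nu}$, and quantum canonical, $\frac1{i\hbar}(x^\mu\star x^\nu-x^\nu\star x^\mu)=\mathcal P^{\mu\nu}$, where $$(\mathcal P^{\mu\nu})=\begin{pmatrix}0_n&I_n&0\\-I_n&0_n&0\\0&0&0_k\end{pmatrix}.$$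 Write again $\star$ and $C_r$ for the star-product and its coefficients expressed in these coordinates (acting on $C^\infty(U)$ and extended to $C^\infty(U)[[\hbar]]$), and let $\star_M$ be the Moyal product on $U$, $$f\star_M g=\sum_{r\ge0}\frac1{r!}\Bigl(\frac{i\hbar}2\Bigr)^r\mathcal P^{\mu_1\nu_1}\cdots\mathcal P^{\mu_r\nu_r}(\partial_{\mu_1}\cdots\partial_{\mu_r}f)(\partial_{\nu_1}\cdots\partial_{\nu_r}g).$$ Let $S=\mathrm{id}+\sum_{r\ge1}\hbar^rS_r$ be the equivalence morphism, i.e. the $S_r$ are differential operators on $C^\infty(U)$ with $S(f\star_M g)=Sf\star Sg$ for all $f,g\in C^\infty(U)[[\hbar]]$ and $Sx^\alpha=x^\alpha$ for all $\alpha$. Write $[S_r,x^\alpha](f)=S_r(x^\alpha f)-x^\alpha S_r(f)$. Then, for all $r\ge1$, all $\alpha$ and all $f\in C^\infty(U)$, the recurrence relations $$[S_r,x^\alpha](f)=\tfrac12\sum_{l=1}^r\bigl(C_l(x^\alpha,S_{r-l}(f))+C_l(S_{r-l}(f),x^\alpha)\bigr)$$ hold and take the form $$[S_1,x^\alpha](f)=0,\qquad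 [S_{2r+1},x^\alpha](f)=\sum_{l=1}^rC_{2l}(x^\alpha,S_{2(r-l)+1}(f)),\qquad [S_{2r},x^\alpha](f)=\sum_{l=1}^rC_{2l}(x^\alpha,S_{2(r-l)}(f)).$$ Consequently $S_{2r+1}=0$ for all $r\ge0$, and the even terms are determined by the last relation: $S_{2r}(1)=0$ for $r\ge1$, and if $T_0=\mathrm{id},T_1,T_2,\dots$ are differential operators on $C^\infty(U)$ with $T_r(1)=0$ and $[T_r,x^\alpha](f)=\sum_{l=1}^rC_{2l}(x^\alpha,T_{r-l}(f))$ for all $r\ge1$, all $\alpha$ and all $f\in C^\infty(U)$, then $T_r=S_{2r}$ for all $r\ge0$. -/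

import Mathlib

open scoped Manifold ContDiff

noncomputable section

namespace DeformQuant

/-! ### Smooth functions and differential operators on an open subset of `ℝ^d` -/

section OpenSubset

variable {d : ℕ}

/-- Extension by zero of a function on an open subset `U` of `ℝ^d`. -/
def extendZero (U : TopologicalSpace.Opens (EuclideanSpace ℝ (Fin d))) (f : U → ℂ) :
    EuclideanSpace ℝ (Fin d) → ℂ :=
  Function.extend Subtype.val f 0

theorem extendZero_apply {U : TopologicalSpace.Opens (EuclideanSpace ℝ (Fin d))} (f : U → ℂ)
    {y : EuclideanSpace ℝ (Fin d)} (hy : y ∈ U) : extendZero U f y = f ⟨y, hy⟩ :=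
  Subtype.val_injective.extend_apply f 0 ⟨y, hy⟩

/-- `C^∞(U)`: the `ℂ`-algebra of smooth complex-valued functions on the open set `U ⊆ ℝ^d`. -/
def SmoothOn (U : TopologicalSpace.Opens (EuclideanSpace ℝ (Fin d))) : Subalgebra ℂ (U → ℂ) where
  carrier := {f | ContDiffOn ℝ ∞ (extendZero U f) U}
  mul_mem' {f g} hf hg := (ContDiffOn.mul hf hg).congr fun y hy => by
    simp [extendZero_apply _ hy]
  add_mem' {f g} hf hg := (ContDiffOn.add hf hg).congr fun y hy => by
    simp [extendZero_apply _ hy]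
  algebraMap_mem' c := (contDiffOn_const (c := c)).congr fun y hy => by
    simp [extendZero_apply _ hy]

variable {U : TopologicalSpace.Opens (EuclideanSpace ℝ (Fin d))}

theorem fderiv_mem (α : Fin d) (f : SmoothOn U) :
    (fun p : U => fderiv ℝ (extendZero U f) p (EuclideanSpace.single α 1)) ∈ SmoothOn U := by
  have h : ContDiffOn ℝ ∞ (fderiv ℝ (extendZero U f)) U :=
    ContDiffOn.fderiv_of_isOpen f.2 U.isOpen (by simp)
  exact (h.clm_apply (contDiffOn_const (c := EuclideanSpace.single α (1 : ℝ)))).congr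
    fun y hy => by rw [extendZero_apply _ hy]

theorem differentiableAt_extendZero (f : SmoothOn U) (p : U) :
    DifferentiableAt ℝ (extendZero U f) p :=
  (ContDiffOn.contDiffAt f.2 (U.isOpen.mem_nhds p.2)).differentiableAt (by simp)

/-- The partial derivative `∂_α = ∂/∂x^α` on `C^∞(U)`. -/
def pderiv (α : Fin d) : SmoothOn U →ₗ[ℂ] SmoothOn U where
  toFun f := ⟨fun p => fderiv ℝ (extendZero U f) p (EuclideanSpace.single α 1), fderiv_mem α f⟩
  map_add' f g := by
    ext p
    have h : extendZero U ((f + g : SmoothOn U) : U → ℂ) =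
        extendZero U f + extendZero U g := by
      funext y
      by_cases hy : y ∈ U
      · simp [extendZero_apply _ hy]
      · have : ¬ ∃ a : U, (a : EuclideanSpace ℝ (Fin d)) = y := by rintro ⟨a, rfl⟩; exact hy a.2
        simp [extendZero, Function.extend_apply' _ _ _ this]
    change fderiv ℝ (extendZero U ((f + g : SmoothOn U) : U → ℂ)) p _ = _
    rw [h, fderiv_add (differentiableAt_extendZero f p) (differentiableAt_extendZero g p)]
    rfl
  map_smul' c f := by
    ext p
    have h : extendZero U ((c • f : SmoothOn U) : U → ℂ) = c • extendZero U f := by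
      funext y
      by_cases hy : y ∈ U
      · simp [extendZero_apply _ hy]
      · have : ¬ ∃ a : U, (a : EuclideanSpace ℝ (Fin d)) = y := by rintro ⟨a, rfl⟩; exact hy a.2
        simp [extendZero, Function.extend_apply' _ _ _ this]
    change fderiv ℝ (extendZero U ((c • f : SmoothOn U) : U → ℂ)) p _ = _
    rw [h, fderiv_const_smul (differentiableAt_extendZero f p)]
    rfl

/-- The iterated partial derivative `∂_I = ∂_{α₁} ⋯ ∂_{α_r}` for `I = (α₁, …, α_r)`. -/
def pderivs : List (Fin d) → SmoothOn U →ₗ[ℂ] SmoothOn U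
  | [] => LinearMap.id
  | α :: I => pderiv α ∘ₗ pderivs I

/-- The coordinate function `x^α` on `U`. -/
def coord (α : Fin d) : SmoothOn U :=
  ⟨fun p => ((p : EuclideanSpace ℝ (Fin d)) α : ℂ), by
    have h : ContDiff ℝ ∞ fun y : EuclideanSpace ℝ (Fin d) => ((y α : ℝ) : ℂ) :=
      (Complex.ofRealCLM.comp (EuclideanSpace.proj α)).contDiff
    exact h.contDiffOn.congr fun y hy => by rw [extendZero_apply _ hy]⟩

/-- A (finite order) differential operator on `C^∞(U)`: a finite sum `f ↦ ∑_I a_I ∂_I f`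
with smooth coefficients. -/
def IsDiffOp (D : SmoothOn U →ₗ[ℂ] SmoothOn U) : Prop :=
  ∃ (s : Finset (List (Fin d))) (a : List (Fin d) → SmoothOn U),
    ∀ f, D f = ∑ I ∈ s, a I * pderivs I f

/-- A (finite order) bidifferential operator on `C^∞(U)`: a finite sum
`(f, g) ↦ ∑_{I,J} a_{I,J} (∂_I f) (∂_J g)` with smooth coefficients. -/
def IsBidiffOp (B : SmoothOn U →ₗ[ℂ] SmoothOn U →ₗ[ℂ] SmoothOn U) : Prop :=
  ∃ (s : Finset (List (Fin d))) (a : List (Fin d) → List (Fin d) → SmoothOn U),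
    ∀ f g, B f g = ∑ I ∈ s, ∑ J ∈ s, a I J * pderivs I f * pderivs J g

end OpenSubset

/-! ### Formal power series in `ħ`

Elements of `C^∞(U)⟦ħ⟧` are power series whose variable `PowerSeries.X` is `ħ`. -/

section Formal

variable {d : ℕ} {U : TopologicalSpace.Opens (EuclideanSpace ℝ (Fin d))}

/-- The `ℂ⟦ħ⟧`-bilinear extension to `C^∞(U)⟦ħ⟧` of `(f, g) ↦ ∑_k ħ^k C_k(f, g)`. -/
def formalProd (C : ℕ → SmoothOn U → SmoothOn U → SmoothOn U)
    (F G : PowerSeries (SmoothOn U)) : PowerSeries (SmoothOn U) :=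
  PowerSeries.mk fun r => ∑ p ∈ Finset.HasAntidiagonal.antidiagonal r, ∑ q ∈ Finset.HasAntidiagonal.antidiagonal p.2,
    C p.1 (PowerSeries.coeff q.1 F) (PowerSeries.coeff q.2 G)

/-- The `ℂ⟦ħ⟧`-linear extension to `C^∞(U)⟦ħ⟧` of `f ↦ ∑_k ħ^k S_k(f)`. -/
def formalMap (S : ℕ → SmoothOn U →ₗ[ℂ] SmoothOn U)
    (F : PowerSeries (SmoothOn U)) : PowerSeries (SmoothOn U) :=
  PowerSeries.mk fun r => ∑ p ∈ Finset.HasAntidiagonal.antidiagonal r, S p.1 (PowerSeries.coeff p.2 F)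

/-- The deformed bracket `(1/(iħ)) (F ⋆ G - G ⋆ F)`. Division by `ħ` shifts the coefficients;
nothing is lost when `C_0(f, g) = f g`, as the commutator then has no term of order `0`. -/
def deformedBracket (C : ℕ → SmoothOn U → SmoothOn U → SmoothOn U)
    (F G : PowerSeries (SmoothOn U)) : PowerSeries (SmoothOn U) :=
  PowerSeries.mk fun r => (1 / Complex.I) •
    PowerSeries.coeff (r + 1) (formalProd C F G - formalProd C G F)

/-- The canonical Poisson matrix `((0, I_n, 0), (-I_n, 0, 0), (0, 0, 0))`,
for `d = 2n + k` (with indices counted from `0`). -/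
def canonicalTensor (d n : ℕ) (μ ν : Fin d) : ℂ :=
  if μ.val < n ∧ ν.val = μ.val + n then 1
  else if ν.val < n ∧ μ.val = ν.val + n then -1
  else 0

/-- The term of order `r` of the Moyal product associated with the canonical Poisson matrix:
`(1/r!) (i/2)^r P^{μ₁ν₁} ⋯ P^{μ_rν_r} (∂_{μ₁} ⋯ ∂_{μ_r} f) (∂_{ν₁} ⋯ ∂_{ν_r} g)`. -/
def moyalTerm (n r : ℕ) (f g : SmoothOn U) : SmoothOn U :=
  ∑ I : Fin r → Fin d, ∑ J : Fin r → Fin d,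
    ((1 / (r.factorial : ℂ)) * (Complex.I / 2) ^ r * ∏ s, canonicalTensor d n (I s) (J s)) •
      (pderivs (List.ofFn I) f * pderivs (List.ofFn J) g)

end Formal

/-! ### Star-products on Poisson manifolds -/

section Manifold

variable {d : ℕ} (M : Type*) [TopologicalSpace M] [ChartedSpace (EuclideanSpace ℝ (Fin d)) M]

/-- `C^∞(M)`: the `ℂ`-algebra of smooth complex-valued functions on the manifold `M`. -/
def SmoothFun : Subalgebra ℂ (M → ℂ) where
  carrier := {f | ContMDiff 𝓘(ℝ, EuclideanSpace ℝ (Fin d)) 𝓘(ℝ, ℂ) ∞ f}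
  mul_mem' {f g} hf hg := by
    have h : ContMDiff 𝓘(ℝ, ℂ × ℂ) 𝓘(ℝ, ℂ) ∞ (fun p : ℂ × ℂ => p.1 * p.2) :=
      contDiff_mul.contMDiff
    exact h.comp (ContMDiff.prodMk_space hf hg)
  add_mem' hf hg := ContMDiff.add hf hg
  algebraMap_mem' c := contMDiff_const (c := c)

/-- A smooth coordinate system on `M`: a homeomorphism from an open domain `𝒪 ⊆ M` onto an open
subset of `ℝ^d`, compatible with the smooth structure. -/
structure Coordinates where
  chart : OpenPartialHomeomorph M (EuclideanSpace ℝ (Fin d))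
  smooth : chart ∈ IsManifold.maximalAtlas 𝓘(ℝ, EuclideanSpace ℝ (Fin d)) ∞ M

variable {M}

/-- The image `U ⊆ ℝ^d` of a coordinate system. -/
def Coordinates.image (x : Coordinates (d := d) M) :
    TopologicalSpace.Opens (EuclideanSpace ℝ (Fin d)) :=
  ⟨x.chart.target, x.chart.open_target⟩

/-- A smooth function on `M` (restricted to the domain) written in the coordinates `x`. -/
def Coordinates.express (x : Coordinates (d := d) M) (f : SmoothFun (d := d) M) :
    SmoothOn x.image :=
  ⟨fun p => (f : M → ℂ) (x.chart.symm p), by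
    have h1 : ContMDiffOn 𝓘(ℝ, EuclideanSpace ℝ (Fin d)) 𝓘(ℝ, ℂ) ∞
        ((f : M → ℂ) ∘ x.chart.symm) x.chart.target :=
      ContMDiff.comp_contMDiffOn f.2 (contMDiffOn_symm_of_mem_maximalAtlas x.smooth)
    exact (contMDiffOn_iff_contDiffOn.1 h1).congr fun y hy =>
      extendZero_apply (U := x.image) _ hy⟩

variable (M) in
/-- A bidifferential operator on `C^∞(M)`: a bilinear map given in every coordinate system by a
bidifferential operator on the image of the coordinates. -/
structure BidiffOp where
  toFun : SmoothFun (d := d) M →ₗ[ℂ] SmoothFun (d := d) M →ₗ[ℂ] SmoothFun (d := d) M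
  isBidiff : ∀ x : Coordinates (d := d) M,
    ∃ B : SmoothOn x.image →ₗ[ℂ] SmoothOn x.image →ₗ[ℂ] SmoothOn x.image,
      IsBidiffOp B ∧ ∀ f g, x.express (toFun f g) = B (x.express f) (x.express g)

/-- The operator on `C^∞(U)` obtained by writing a bidifferential operator on `M` in the
coordinates `x` with image `U`. On a Hausdorff `M` it is uniquely determined, since
bidifferential operators are local. -/
def BidiffOp.inCoords (B : BidiffOp (d := d) M) (x : Coordinates (d := d) M) :
    SmoothOn x.image →ₗ[ℂ] SmoothOn x.image →ₗ[ℂ] SmoothOn x.image :=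
  (B.isBidiff x).choose

variable (M) in
/-- A Poisson structure on `M`, given by its Poisson bracket on complex-valued smooth functions.
Being a skew real biderivation given by bidifferential operators, the bracket is
`{f, g} = P(df, dg)` for a real bivector field `P`. -/
structure PoissonStructure where
  bracket : BidiffOp (d := d) M
  skew : ∀ f g, bracket.toFun f g = -bracket.toFun g f
  leibniz : ∀ f g h,
    bracket.toFun f (g * h) = bracket.toFun f g * h + g * bracket.toFun f h
  jacobi : ∀ f g h, bracket.toFun f (bracket.toFun g h) + bracket.toFun g (bracket.toFun h f) +
    bracket.toFun h (bracket.toFun f g) = 0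
  real : ∀ f g : SmoothFun (d := d) M, (∀ p, ((f : M → ℂ) p).im = 0) →
    (∀ p, ((g : M → ℂ) p).im = 0) → ∀ p, ((bracket.toFun f g : M → ℂ) p).im = 0

/-- A star-product `f ⋆ g = ∑_k ħ^k C_k(f, g)` on the Poisson manifold `(M, P)`. -/
structure StarProduct (P : PoissonStructure (d := d) M) where
  C : ℕ → BidiffOp (d := d) M
  zero : ∀ f g, (C 0).toFun f g = f * g
  one : ∀ f g, (C 1).toFun f g - (C 1).toFun g f = Complex.I • P.bracket.toFun f g
  assoc : ∀ (k : ℕ) (f g h), ∑ p ∈ Finset.HasAntidiagonal.antidiagonal k,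
    ((C p.1).toFun ((C p.2).toFun f g) h - (C p.1).toFun f ((C p.2).toFun g h)) = 0
  unit_right : ∀ k, 1 ≤ k → ∀ f, (C k).toFun f 1 = 0
  unit_left : ∀ k, 1 ≤ k → ∀ f, (C k).toFun 1 f = 0

variable {P : PoissonStructure (d := d) M}

/-- The parity condition `C_k(f, g) = (-1)^k C_k(g, f)` on `C^∞(M)`. -/
def StarProduct.Parity (A : StarProduct P) : Prop :=
  ∀ (k : ℕ) (f g : SmoothFun (d := d) M),
    (A.C k).toFun f g = (-1 : ℂ) ^ k • (A.C k).toFun g f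

/-- The operators `C_k` of the star-product written in the coordinates `x`. -/
def StarProduct.term (A : StarProduct P) (x : Coordinates (d := d) M) (k : ℕ)
    (f g : SmoothOn x.image) : SmoothOn x.image :=
  (A.C k).inCoords x f g

/-- Classical canonical coordinates: `{x^μ, x^ν} = P^{μν}` with `P^{μν}` canonical. -/
def ClassicalCanonical (n : ℕ) (P : PoissonStructure (d := d) M) (x : Coordinates (d := d) M) :
    Prop :=
  ∀ μ ν : Fin d, P.bracket.inCoords x (coord μ) (coord ν) =
    algebraMap ℂ (SmoothOn x.image) (canonicalTensor d n μ ν)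

/-- Quantum canonical coordinates: `⟦x^μ, x^ν⟧ = P^{μν}` with `P^{μν}` canonical. -/
def QuantumCanonical (n : ℕ) (A : StarProduct P) (x : Coordinates (d := d) M) : Prop :=
  ∀ μ ν : Fin d,
    deformedBracket (A.term x) (PowerSeries.C (coord μ)) (PowerSeries.C (coord ν)) =
      PowerSeries.C (algebraMap ℂ (SmoothOn x.image) (canonicalTensor d n μ ν))

/-- `S = id + ∑_{k ≥ 1} ħ^k S_k` is a series of differential operators `S_k` on `C^∞(U)` with
`S(F ⋆_M G) = S(F) ⋆ S(G)` and `S(x^α) = x^α`, where `⋆` is the star-product written in the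
coordinates `x` and `⋆_M` is the Moyal product in these coordinates. -/
structure IsMoyalEquivalence (n : ℕ) (A : StarProduct P) (x : Coordinates (d := d) M)
    (S : ℕ → SmoothOn x.image →ₗ[ℂ] SmoothOn x.image) : Prop where
  zero : S 0 = LinearMap.id
  diffOp : ∀ k, IsDiffOp (S k)
  map_prod : ∀ F G : PowerSeries (SmoothOn x.image),
    formalMap S (formalProd (moyalTerm n) F G) =
      formalProd (A.term x) (formalMap S F) (formalMap S G)
  map_coord : ∀ α : Fin d,
    formalMap S (PowerSeries.C (coord α)) = PowerSeries.C (coord α)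

/-- The commutator `[D, x^α]` of an operator with multiplication by the coordinate `x^α`. -/
def commCoord {U : TopologicalSpace.Opens (EuclideanSpace ℝ (Fin d))}
    (D : SmoothOn U →ₗ[ℂ] SmoothOn U) (α : Fin d) (f : SmoothOn U) : SmoothOn U :=
  D (coord α * f) - coord α * D f

end Manifold

end DeformQuant

end

open scoped Manifold ContDiff
open DeformQuant

open scoped Manifold ContDiff

noncomputable section

namespace DeformQuant

open scoped Topology IsMulCommutative

/-! ### Partial derivatives on `C^∞(U)`, locality, and commutators with the coordinates. -/

section OpenSubset

variable {d : ℕ} {U : TopologicalSpace.Opens (EuclideanSpace ℝ (Fin d))}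

/-! Apply `S(f ⋆_M g) = Sf ⋆ Sg` with one factor equal to `x^α`, in both orders, and add. The Moyal
anticommutator of `x^α` and `f` is exactly `2 x^α f`: the first-order term is antisymmetric, and
from order two on `x^α` is differentiated at least twice (`moyalTerm_coord_add`). The coefficient of
`ħ^r` is then the general recurrence, whose commutator comes from moving the `l = 0` term to the
left. Under parity the odd `l` cancel and the even `l` double, which absorbs the factor `1/2`.

The consequences rest on `IsDiffOp.eq_of_commCoord_eq`. With coefficients frozen at a point, a
differential operator becomes a polynomial in the `∂_α`, and commutation with `x^α` differentiates
this polynomial in the variable `∂_α`. Vanishing commutators thus leave only a multiplication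
operator, fixed by its value at `1`. Since `S(1)` is a `⋆`-idempotent with leading term `1`, `S_r(1)
= 0` for `r ≥ 1`. The recurrence preserves the parity of the index, so strong induction kills the
odd terms and identifies the even ones.

The axioms of `⋆` concern functions on `M`. They pass to `C^∞(U)` by locality of bidifferential
operators and by cutting off functions on `U` with bumps. -/

theorem extendZero_coe (f : U → ℂ) (p : U) : extendZero U f p = f p :=
  extendZero_apply f p.2

theorem pderiv_apply (α : Fin d) (f : SmoothOn U) (p : U) :
    (pderiv α f : U → ℂ) p =
      fderiv ℝ (extendZero U f) p (EuclideanSpace.single α 1) := rfl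

theorem pderiv_mul (α : Fin d) (f g : SmoothOn U) :
    pderiv α (f * g) = pderiv α f * g + f * pderiv α g := by
  ext p
  have h : extendZero U ((f * g : SmoothOn U) : U → ℂ) =ᶠ[𝓝 (p : EuclideanSpace ℝ (Fin d))]
      (fun y => extendZero U f y * extendZero U g y) := by
    filter_upwards [U.isOpen.mem_nhds p.2] with y hy
    simp [extendZero_apply _ hy]
  change fderiv ℝ (extendZero U _) (p : EuclideanSpace ℝ (Fin d)) _ =
    fderiv ℝ (extendZero U f) p _ * (g : U → ℂ) p + (f : U → ℂ) p * fderiv ℝ (extendZero U g) p _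
  rw [h.fderiv_eq,
    fderiv_fun_mul (differentiableAt_extendZero f p) (differentiableAt_extendZero g p)]
  simp only [extendZero_coe, add_apply, smul_apply,
    smul_eq_mul]
  ring

theorem pderiv_coord (α β : Fin d) :
    pderiv α (coord β : SmoothOn U) = if β = α then 1 else 0 := by
  ext p
  have h : extendZero U ((coord β : SmoothOn U) : U → ℂ)
      =ᶠ[𝓝 (p : EuclideanSpace ℝ (Fin d))]
      (Complex.ofRealCLM.comp (EuclideanSpace.proj β) : EuclideanSpace ℝ (Fin d) →L[ℝ] ℂ) := by
    filter_upwards [U.isOpen.mem_nhds p.2] with y hy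
    rw [extendZero_apply _ hy]
    rfl
  rw [pderiv_apply, h.fderiv_eq, ContinuousLinearMap.fderiv]
  by_cases hab : β = α <;> simp [hab]

theorem pderiv_one (α : Fin d) : pderiv α (1 : SmoothOn U) = 0 := by
  simpa using pderiv_mul α (1 : SmoothOn U) 1

theorem pderiv_comm (α β : Fin d) (f : SmoothOn U) :
    pderiv α (pderiv β f) = pderiv β (pderiv α f) := by
  have key : ∀ (γ δ : Fin d) (p : U), (pderiv γ (pderiv δ f) : U → ℂ) p =
      fderiv ℝ (fderiv ℝ (extendZero U f)) p (EuclideanSpace.single γ 1)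
        (EuclideanSpace.single δ 1) := by
    intro γ δ p
    have h : extendZero U (pderiv δ f : SmoothOn U) =ᶠ[𝓝 (p : EuclideanSpace ℝ (Fin d))]
        fun y => fderiv ℝ (extendZero U f) y (EuclideanSpace.single δ 1) := by
      filter_upwards [U.isOpen.mem_nhds p.2] with y hy
      rw [extendZero_apply _ hy, pderiv_apply]
    have hd : DifferentiableAt ℝ (fderiv ℝ (extendZero U f)) p :=
      ((ContDiffOn.fderiv_of_isOpen (m := ∞) f.2 U.isOpen (by simp)).contDiffAt
        (U.isOpen.mem_nhds p.2)).differentiableAt (by simp)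
    rw [pderiv_apply, h.fderiv_eq, fderiv_clm_apply hd (differentiableAt_const _)]
    simp
  ext p
  rw [key, key]
  have hs : IsSymmSndFDerivAt ℝ (extendZero U f) p :=
    (ContDiffOn.contDiffAt f.2 (U.isOpen.mem_nhds p.2)).isSymmSndFDerivAt (by
      rw [minSmoothness_of_isRCLikeNormedField]; exact WithTop.coe_le_coe.2 le_top)
  exact hs _ _

/-- Equality on a neighbourhood, unlike equality at `p`, survives differentiation and so can be
carried through the induction. -/
theorem pderivs_congr {f g : SmoothOn U} {p : U}
    (h : extendZero U f =ᶠ[𝓝 (p : EuclideanSpace ℝ (Fin d))] extendZero U g)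
    (I : List (Fin d)) :
    extendZero U (pderivs I f : SmoothOn U) =ᶠ[𝓝 (p : EuclideanSpace ℝ (Fin d))]
      extendZero U (pderivs I g : SmoothOn U) := by
  induction I with
  | nil => exact h
  | cons α I ih =>
    filter_upwards [ih.fderiv (𝕜 := ℝ), U.isOpen.mem_nhds p.2] with y hy hU
    rw [extendZero_apply _ hU, extendZero_apply _ hU]
    exact congrArg (fun T : EuclideanSpace ℝ (Fin d) →L[ℝ] ℂ => T (EuclideanSpace.single α (1 : ℝ))) hy

/-- Bidifferential operators are local. -/
theorem IsBidiffOp.congr {B : SmoothOn U →ₗ[ℂ] SmoothOn U →ₗ[ℂ] SmoothOn U} (hB : IsBidiffOp B)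
    {f f' g g' : SmoothOn U} {p : U}
    (hf : extendZero U f =ᶠ[𝓝 (p : EuclideanSpace ℝ (Fin d))] extendZero U f')
    (hg : extendZero U g =ᶠ[𝓝 (p : EuclideanSpace ℝ (Fin d))] extendZero U g') :
    (B f g : U → ℂ) p = (B f' g' : U → ℂ) p := by
  obtain ⟨s, a, h⟩ := hB
  have hf' := fun I => (pderivs_congr hf I).eq_of_nhds
  have hg' := fun I => (pderivs_congr hg I).eq_of_nhds
  simp only [extendZero_coe] at hf' hg'
  rw [h, h]
  simp [Finset.sum_apply, hf', hg']

/-! ### Constant coefficient differential operators -/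

/-- The commutative algebra generated by the partial derivatives. -/
def pderivAlgebra (U : TopologicalSpace.Opens (EuclideanSpace ℝ (Fin d))) :
    Subalgebra ℂ (Module.End ℂ (SmoothOn U)) :=
  Algebra.adjoin ℂ (Set.range (pderiv (U := U)))

/-- Symmetry of second derivatives makes the generators commute; this commutativity is what allows
polynomials to be evaluated at them. -/
instance : IsMulCommutative (pderivAlgebra U) :=
  Algebra.isMulCommutative_adjoin ℂ (by
    rintro _ ⟨α, rfl⟩ _ ⟨β, rfl⟩
    exact LinearMap.ext fun f => pderiv_comm α β f)

/-- The constant coefficient differential operator with symbol `Q`. -/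
def constCoeffOp (U : TopologicalSpace.Opens (EuclideanSpace ℝ (Fin d))) :
    MvPolynomial (Fin d) ℂ →ₐ[ℂ] Module.End ℂ (SmoothOn U) :=
  (pderivAlgebra U).val.comp (MvPolynomial.aeval fun α =>
    (⟨pderiv α, Algebra.subset_adjoin ⟨α, rfl⟩⟩ : pderivAlgebra U))

theorem constCoeffOp_X (α : Fin d) : constCoeffOp U (MvPolynomial.X α) = pderiv α := by
  simp [constCoeffOp]

theorem constCoeffOp_prod_X (I : List (Fin d)) :
    constCoeffOp U (I.map MvPolynomial.X).prod = pderivs I := by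
  induction I with
  | nil => simp [pderivs]; rfl
  | cons α I ih => simp [pderivs, ih, constCoeffOp_X]; rfl

theorem constCoeffOp_C (c : ℂ) (f : SmoothOn U) : constCoeffOp U (MvPolynomial.C c) f = c • f := by
  rw [← MvPolynomial.algebraMap_eq, AlgHom.commutes]
  rfl

/-- The Heisenberg relation `[∂_β, x^α] = δ_{αβ}`, extended to all polynomials because both `[·,
x^α]` and the formal derivative are derivations. -/
theorem constCoeffOp_coord_mul (Q : MvPolynomial (Fin d) ℂ) (α : Fin d) (f : SmoothOn U) :
    constCoeffOp U Q (coord α * f) =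
      coord α * constCoeffOp U Q f + constCoeffOp U (MvPolynomial.pderiv α Q) f := by
  induction Q using MvPolynomial.induction_on generalizing f with
  | C c => simp
  | add Q R hQ hR => simp only [map_add, LinearMap.add_apply, hQ, hR]; ring
  | mul_X Q β ih =>
    rw [MvPolynomial.pderiv_mul, MvPolynomial.pderiv_X, map_add, LinearMap.add_apply]
    simp only [map_mul, Module.End.mul_apply, constCoeffOp_X, pderiv_mul, pderiv_coord, map_add, ih]
    by_cases h : α = β
    · subst h; simp; ring
    · simp [h, Ne.symm h]

theorem _root_.Finsupp.exists_eq_add_single {σ : Type*} {m : σ →₀ ℕ} (hm : m ≠ 0) :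
    ∃ m' α, m = m' + Finsupp.single α 1 := by
  obtain ⟨α, hα⟩ := Finsupp.ne_iff.1 hm
  refine ⟨m - Finsupp.single α 1, α, (tsub_add_cancel_of_le ?_).symm⟩
  simpa [Finsupp.single_le_iff] using Nat.one_le_iff_ne_zero.2 hα

theorem coeff_add_single_eq_zero {σ : Type*} {Q : MvPolynomial σ ℂ} {m : σ →₀ ℕ} {α : σ}
    (h : MvPolynomial.coeff m (MvPolynomial.pderiv α Q) = 0) :
    MvPolynomial.coeff (m + Finsupp.single α 1) Q = 0 := by
  rw [MvPolynomial.coeff_pderiv] at h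
  exact (mul_eq_zero.1 h).resolve_right (Nat.cast_add_one_ne_zero _)

theorem eq_C_of_pderiv_eq_zero {σ : Type*} {Q : MvPolynomial σ ℂ}
    (h : ∀ α, MvPolynomial.pderiv α Q = 0) : Q = MvPolynomial.C (MvPolynomial.coeff 0 Q) := by
  classical
  ext m
  rw [MvPolynomial.coeff_C]
  split_ifs with hm
  · rw [hm]
  · obtain ⟨m', α, rfl⟩ := Finsupp.exists_eq_add_single (Ne.symm hm)
    exact coeff_add_single_eq_zero (by rw [h, MvPolynomial.coeff_zero])

theorem constCoeffOp_one (Q : MvPolynomial (Fin d) ℂ) :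
    constCoeffOp U Q 1 = MvPolynomial.coeff 0 Q • 1 := by
  induction Q using MvPolynomial.induction_on with
  | C c => simp
  | add Q R hQ hR => simp only [map_add, LinearMap.add_apply, hQ, hR, MvPolynomial.coeff_add, add_smul]
  | mul_X Q β ih => simp [constCoeffOp_X, pderiv_one, MvPolynomial.coeff_mul_X']

/-- Testing on `1` reads off the constant coefficient. By the Heisenberg relation the hypothesis
passes to every derivative of `Q`, so higher coefficients follow by induction on the degree,
dividing by nonzero integers. -/
theorem eq_zero_of_constCoeffOp_apply_eq_zero (p : U) (Q : MvPolynomial (Fin d) ℂ)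
    (h : ∀ f, (constCoeffOp U Q f : U → ℂ) p = 0) : Q = 0 := by
  ext m
  rw [MvPolynomial.coeff_zero]
  induction hN : m.degree generalizing m Q with
  | zero =>
    rw [Finsupp.degree_eq_zero_iff] at hN
    simpa [constCoeffOp_one, hN] using h 1
  | succ N ih =>
    obtain ⟨m', α, rfl⟩ := Finsupp.exists_eq_add_single (m := m) (by rintro rfl; simp at hN)
    refine coeff_add_single_eq_zero (ih _ (fun f => ?_) m' (by simpa using hN))
    have h1 := congrArg (fun F : SmoothOn U => (F : U → ℂ) p) (constCoeffOp_coord_mul Q α f)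
    simpa [h] using h1.symm

/-- A differential operator which commutes with the coordinates is a multiplication operator. -/
theorem IsDiffOp.eq_mul_of_commCoord_eq_zero {D : SmoothOn U →ₗ[ℂ] SmoothOn U} (hD : IsDiffOp D)
    (h : ∀ α f, commCoord D α f = 0) (f : SmoothOn U) : D f = D 1 * f := by
  obtain ⟨s, a, hDs⟩ := hD
  ext p
  -- The symbol of `D` with its coefficients frozen at `p`; it computes `D g` at `p` only, which
  -- suffices because multiplication by `x^α` also acts pointwise.
  set Q : MvPolynomial (Fin d) ℂ :=
    ∑ I ∈ s, (a I : U → ℂ) p • (I.map MvPolynomial.X).prod with hQ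
  have hDQ : ∀ g, (D g : U → ℂ) p = (constCoeffOp U Q g : U → ℂ) p := by
    intro g
    simp [hDs, hQ, constCoeffOp_prod_X, Finset.sum_apply]
  have h0 : ∀ α, MvPolynomial.pderiv α Q = 0 := by
    intro α
    refine eq_zero_of_constCoeffOp_apply_eq_zero p _ fun g => ?_
    have h1 := congrArg (fun F : SmoothOn U => (F : U → ℂ) p) (h α g)
    have h2 := congrArg (fun F : SmoothOn U => (F : U → ℂ) p) (constCoeffOp_coord_mul Q α g)
    simp only [commCoord, AddSubgroupClass.coe_sub, Pi.sub_apply, MulMemClass.coe_mul, Pi.mul_apply,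
      AddMemClass.coe_add, Pi.add_apply, hDQ, ZeroMemClass.coe_zero, Pi.zero_apply] at h1 h2
    linear_combination h1 - h2
  change (D f : U → ℂ) p = (D 1 : U → ℂ) p * (f : U → ℂ) p
  rw [hDQ, hDQ, eq_C_of_pderiv_eq_zero h0, constCoeffOp_C, constCoeffOp_C]
  simp

theorem IsDiffOp.sub {D D' : SmoothOn U →ₗ[ℂ] SmoothOn U} (hD : IsDiffOp D) (hD' : IsDiffOp D') :
    IsDiffOp (D - D') := by
  classical
  obtain ⟨s, a, h⟩ := hD
  obtain ⟨s', a', h'⟩ := hD'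
  -- Coefficients outside the original index sets are arbitrary, so they are cut to zero before the
  -- two expansions are merged.
  refine ⟨s ∪ s', fun I => (if I ∈ s then a I else 0) - (if I ∈ s' then a' I else 0), fun f => ?_⟩
  simp only [LinearMap.sub_apply, h, h', sub_mul, Finset.sum_sub_distrib, ite_mul, zero_mul,
    Finset.sum_ite_mem, Finset.union_inter_cancel_left, Finset.union_inter_cancel_right]

/-- A differential operator is determined by its value at `1` and its commutators with the
coordinates. -/
theorem IsDiffOp.eq_of_commCoord_eq {D D' : SmoothOn U →ₗ[ℂ] SmoothOn U} (hD : IsDiffOp D)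
    (hD' : IsDiffOp D') (h : ∀ α f, commCoord D α f = commCoord D' α f) (h1 : D 1 = D' 1) :
    D = D' := by
  ext1 f
  have := (hD.sub hD').eq_mul_of_commCoord_eq_zero (fun α g => ?_) f
  · simpa [h1, sub_eq_zero] using this
  · have hg := h α g
    simp only [commCoord, LinearMap.sub_apply] at hg ⊢
    linear_combination hg

end OpenSubset

/-! ### Transfer of the star-product axioms from `M` to coordinates. -/

section Coordinates

variable {d : ℕ} {M : Type*} [TopologicalSpace M] [ChartedSpace (EuclideanSpace ℝ (Fin d)) M]

/-- On a Hausdorff manifold, every smooth function on the image of a coordinate system agrees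
near any given point with a globally defined smooth function. -/
theorem Coordinates.exists_express_eventuallyEq [T2Space M]
    [IsManifold 𝓘(ℝ, EuclideanSpace ℝ (Fin d)) ∞ M]
    (x : Coordinates (d := d) M) (f : SmoothOn x.image) (p : x.image) :
    ∃ F : SmoothFun (d := d) M,
      extendZero x.image (x.express F) =ᶠ[𝓝 (p : EuclideanSpace ℝ (Fin d))]
        extendZero x.image f := by
  classical
  obtain ⟨R, hR, hsub⟩ := Metric.nhds_basis_closedBall.mem_iff.1 (x.image.isOpen.mem_nhds p.2)
  -- The bump is `1` near `p` and vanishes outside a ball whose closure lies in the image of the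
  -- chart.
  let φ : ContDiffBump (p : EuclideanSpace ℝ (Fin d)) := ⟨R / 2, R, by linarith, by linarith⟩
  let h : EuclideanSpace ℝ (Fin d) → ℂ := fun y => φ y • extendZero x.image f y
  have hh : ∀ y ∈ x.chart.target, ContDiffAt ℝ ∞ h y := fun y hy =>
    φ.contDiff.contDiffAt.smul (ContDiffOn.contDiffAt f.2 (x.image.isOpen.mem_nhds hy))
  let F : M → ℂ := fun m => if m ∈ x.chart.source then h (x.chart m) else 0
  let K : Set M := x.chart.symm '' Metric.closedBall (p : EuclideanSpace ℝ (Fin d)) R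
  -- The Hausdorff property enters here: the compact set `K` is closed, so the extension by zero
  -- vanishes on an open set and is smooth there.
  have hK : IsClosed K := ((isCompact_closedBall _ _).image_of_continuousOn
    (x.chart.continuousOn_symm.mono hsub)).isClosed
  have hKs : K ⊆ x.chart.source := by
    rintro _ ⟨y, hy, rfl⟩
    exact x.chart.map_target (hsub hy)
  have hF0 : ∀ m ∉ K, F m = 0 := by
    intro m hm
    by_cases hs : m ∈ x.chart.source
    · have : φ (x.chart m) = 0 := by
        refine φ.zero_of_le_dist (le_of_lt (not_le.1 fun hle => hm ?_))
        exact ⟨x.chart m, hle, x.chart.left_inv hs⟩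
      simp [F, h, hs, this]
    · simp [F, hs]
  have hF : ContMDiff 𝓘(ℝ, EuclideanSpace ℝ (Fin d)) 𝓘(ℝ, ℂ) ∞ F := by
    intro m
    by_cases hm : m ∈ K
    · have hs := hKs hm
      have h1 : ContMDiffAt 𝓘(ℝ, EuclideanSpace ℝ (Fin d)) 𝓘(ℝ, ℂ) ∞ (h ∘ x.chart) m :=
        (hh _ (x.chart.map_source hs)).contMDiffAt.comp m
          (contMDiffAt_of_mem_maximalAtlas x.smooth hs)
      refine h1.congr_of_eventuallyEq ?_
      filter_upwards [x.chart.open_source.mem_nhds hs] with z hz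
      simp [F, hz]
    · refine (contMDiffAt_const (c := (0 : ℂ))).congr_of_eventuallyEq ?_
      filter_upwards [hK.isOpen_compl.mem_nhds hm] with z hz using hF0 z hz
  refine ⟨⟨F, hF⟩, ?_⟩
  filter_upwards [φ.eventuallyEq_one, x.image.isOpen.mem_nhds p.2] with y h1 hy
  have hy' : y ∈ x.chart.target := hy
  rw [extendZero_apply _ hy]
  change F (x.chart.symm y) = _
  simp [F, h, x.chart.map_target hy', x.chart.right_inv hy', h1]

theorem BidiffOp.express_toFun (B : BidiffOp (d := d) M) (x : Coordinates (d := d) M)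
    (f g : SmoothFun (d := d) M) :
    x.express (B.toFun f g) = B.inCoords x (x.express f) (x.express g) :=
  (B.isBidiff x).choose_spec.2 f g

theorem StarProduct.term_zero_left {P : PoissonStructure (d := d) M} (A : StarProduct P)
    {x : Coordinates (d := d) M} (k : ℕ) (f : SmoothOn x.image) : A.term x k 0 f = 0 := by
  simp [StarProduct.term]

theorem StarProduct.term_zero_right {P : PoissonStructure (d := d) M} (A : StarProduct P)
    {x : Coordinates (d := d) M} (k : ℕ) (f : SmoothOn x.image) : A.term x k f 0 = 0 := by
  simp [StarProduct.term]

theorem StarProduct.term_one_one {P : PoissonStructure (d := d) M} (A : StarProduct P)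
    (x : Coordinates (d := d) M) {k : ℕ} (hk : 1 ≤ k) : A.term x k 1 1 = 0 := by
  have h := (A.C k).express_toFun x 1 1
  rw [A.unit_right k hk] at h
  exact h.symm

variable [T2Space M] [IsManifold 𝓘(ℝ, EuclideanSpace ℝ (Fin d)) ∞ M]

/-- Locally, an operator in coordinates is computed from global functions. -/
theorem BidiffOp.exists_inCoords_apply_eq
    (x : Coordinates (d := d) M) (f g : SmoothOn x.image) (p : x.image) :
    ∃ F G : SmoothFun (d := d) M,
      (x.express F : x.image → ℂ) p = (f : x.image → ℂ) p ∧
      (x.express G : x.image → ℂ) p = (g : x.image → ℂ) p ∧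
      ∀ B : BidiffOp (d := d) M,
        (B.inCoords x f g : x.image → ℂ) p = (x.express (B.toFun F G) : x.image → ℂ) p ∧
        (B.inCoords x g f : x.image → ℂ) p = (x.express (B.toFun G F) : x.image → ℂ) p := by
  -- The representatives depend only on the germs of `f` and `g` at `p`. They serve all operators
  -- and both orders of the arguments at once, as the parity condition requires.
  obtain ⟨F, hF⟩ := x.exists_express_eventuallyEq f p
  obtain ⟨G, hG⟩ := x.exists_express_eventuallyEq g p
  refine ⟨F, G, by simpa only [extendZero_coe] using hF.eq_of_nhds,
    by simpa only [extendZero_coe] using hG.eq_of_nhds, fun B => ?_⟩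
  have hB : IsBidiffOp (B.inCoords x) := (B.isBidiff x).choose_spec.1
  rw [B.express_toFun, B.express_toFun]
  exact ⟨hB.congr hF.symm hG.symm, hB.congr hG.symm hF.symm⟩

variable {P : PoissonStructure (d := d) M} (A : StarProduct P) (x : Coordinates (d := d) M)

theorem StarProduct.term_zero (f g : SmoothOn x.image) : A.term x 0 f g = f * g := by
  ext p
  obtain ⟨F, G, hF, hG, h⟩ := BidiffOp.exists_inCoords_apply_eq x f g p
  refine (h (A.C 0)).1.trans ?_
  rw [A.zero]
  exact congrArg₂ (· * ·) hF hG

theorem StarProduct.Parity.term {A : StarProduct P} (hA : A.Parity) (k : ℕ)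
    (f g : SmoothOn x.image) : A.term x k f g = (-1 : ℂ) ^ k • A.term x k g f := by
  ext p
  obtain ⟨F, G, -, -, h⟩ := BidiffOp.exists_inCoords_apply_eq x f g p
  refine (h (A.C k)).1.trans ?_
  rw [hA k F G]
  exact congrArg ((-1 : ℂ) ^ k * ·) (h (A.C k)).2.symm

end Coordinates

/-! ### Coefficients of formal products, and the Moyal product with a coordinate. -/

section Formal

variable {d : ℕ} {U : TopologicalSpace.Opens (EuclideanSpace ℝ (Fin d))}

open Finset in
theorem coeff_formalMap_C (S : ℕ → SmoothOn U →ₗ[ℂ] SmoothOn U) (f : SmoothOn U) (r : ℕ) :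
    PowerSeries.coeff r (formalMap S (PowerSeries.C f)) = S r f := by
  rw [formalMap, PowerSeries.coeff_mk, sum_eq_single (r, 0)]
  · simp
  · rintro ⟨a, b⟩ hab hne
    have hb : b ≠ 0 := by
      rintro rfl
      exact hne (by simpa using hab)
    simp [PowerSeries.coeff_C, hb]
  · simp

open Finset in
theorem coeff_formalProd_C_left (C : ℕ → SmoothOn U → SmoothOn U → SmoothOn U)
    (hC : ∀ k g, C k 0 g = 0) (f : SmoothOn U) (G : PowerSeries (SmoothOn U)) (r : ℕ) :
    PowerSeries.coeff r (formalProd C (PowerSeries.C f) G) =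
      ∑ p ∈ antidiagonal r, C p.1 f (PowerSeries.coeff p.2 G) := by
  rw [formalProd, PowerSeries.coeff_mk]
  refine sum_congr rfl fun p _ => ?_
  rw [sum_eq_single (0, p.2)]
  · simp
  · rintro ⟨a, b⟩ hab hne
    have ha : a ≠ 0 := by
      rintro rfl
      exact hne (by simpa using hab)
    simp [PowerSeries.coeff_C, ha, hC]
  · simp

open Finset in
theorem coeff_formalProd_C_right (C : ℕ → SmoothOn U → SmoothOn U → SmoothOn U)
    (hC : ∀ k g, C k g 0 = 0) (f : SmoothOn U) (G : PowerSeries (SmoothOn U)) (r : ℕ) :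
    PowerSeries.coeff r (formalProd C G (PowerSeries.C f)) =
      ∑ p ∈ antidiagonal r, C p.1 (PowerSeries.coeff p.2 G) f := by
  rw [formalProd, PowerSeries.coeff_mk]
  refine sum_congr rfl fun p _ => ?_
  rw [sum_eq_single (p.2, 0)]
  · simp
  · rintro ⟨a, b⟩ hab hne
    have hb : b ≠ 0 := by
      rintro rfl
      exact hne (by simpa using hab)
    simp [PowerSeries.coeff_C, hb, hC]
  · simp

theorem moyalTerm_zero_left (n r : ℕ) (g : SmoothOn U) : moyalTerm n r 0 g = 0 := by
  simp [moyalTerm]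

theorem moyalTerm_zero_right (n r : ℕ) (f : SmoothOn U) : moyalTerm n r f 0 = 0 := by
  simp [moyalTerm]

theorem moyalTerm_order_zero (n : ℕ) (f g : SmoothOn U) : moyalTerm n 0 f g = f * g := by
  simp [moyalTerm, pderivs]

theorem pderivs_of_pderiv_eq_zero {f : SmoothOn U} (h : ∀ α β, pderiv α (pderiv β f) = 0)
    {I : List (Fin d)} (hI : 2 ≤ I.length) : pderivs I f = 0 := by
  induction I with
  | nil => simp at hI
  | cons α I ih =>
    rcases I with _ | ⟨β, _ | ⟨γ, I⟩⟩
    · simp at hI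
    · exact h α β
    · rw [pderivs, LinearMap.comp_apply, ih (by simp), map_zero]

theorem pderiv_pderiv_coord (α β γ : Fin d) : pderiv α (pderiv β (coord γ : SmoothOn U)) = 0 := by
  rw [pderiv_coord]
  split_ifs
  · exact pderiv_one α
  · exact map_zero _

theorem moyalTerm_one_one {n r : ℕ} (hr : 1 ≤ r) : moyalTerm n r (1 : SmoothOn U) 1 = 0 := by
  obtain ⟨r, rfl⟩ := Nat.exists_eq_add_of_le' hr
  have h : ∀ I : Fin (r + 1) → Fin d, pderivs (List.ofFn I) (1 : SmoothOn U) = 0 := by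
    intro I
    rw [List.ofFn_succ]
    generalize List.ofFn (fun i => I (Fin.succ i)) = L
    generalize I 0 = α
    induction L generalizing α with
    | nil => exact pderiv_one α
    | cons β L ih => rw [pderivs, LinearMap.comp_apply, ih, map_zero]
  simp only [moyalTerm, h, mul_zero, smul_zero, Finset.sum_const_zero]

theorem canonicalTensor_antisymm (d n : ℕ) (μ ν : Fin d) :
    canonicalTensor d n μ ν = -canonicalTensor d n ν μ := by
  unfold canonicalTensor
  split_ifs <;> first | simp | omega

/-- The Moyal anticommutator with a coordinate has no terms of positive order. -/
theorem moyalTerm_coord_add {n r : ℕ} (hr : 1 ≤ r) (α : Fin d) (f : SmoothOn U) :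
    moyalTerm n r (coord α) f + moyalTerm n r f (coord α) = 0 := by
  rcases hr.eq_or_lt with rfl | hr
  · unfold moyalTerm
    -- Exchanging `I` and `J` in the second sum pairs each term with its negative: at order one the
    -- product of tensors has a single factor, which is antisymmetric.
    nth_rw 2 [Finset.sum_comm]
    simp only [← Finset.sum_add_distrib]
    refine Finset.sum_eq_zero fun I _ => Finset.sum_eq_zero fun J _ => ?_
    have h : ∏ s, canonicalTensor d n (J s) (I s) = -∏ s, canonicalTensor d n (I s) (J s) := by
      simpa using canonicalTensor_antisymm d n (J 0) (I 0)
    rw [h, mul_comm (pderivs (List.ofFn J) f), ← add_smul]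
    simp
  · have h : ∀ I : Fin r → Fin d, pderivs (List.ofFn I) (coord α : SmoothOn U) = 0 := fun I =>
      pderivs_of_pderiv_eq_zero (fun β γ => pderiv_pderiv_coord β γ α) (by rw [List.length_ofFn]; exact hr)
    simp [moyalTerm, h]

end Formal

/-! ### Recurrence relations for the equivalence morphism. -/

section Equivalence

variable {d n : ℕ} {M : Type*} [TopologicalSpace M] [T2Space M]
  [ChartedSpace (EuclideanSpace ℝ (Fin d)) M] [IsManifold 𝓘(ℝ, EuclideanSpace ℝ (Fin d)) ∞ M]
  {P : PoissonStructure (d := d) M} {A : StarProduct P} {x : Coordinates (d := d) M}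
  {S : ℕ → SmoothOn x.image →ₗ[ℂ] SmoothOn x.image}

open Finset in
theorem IsMoyalEquivalence.commCoord_eq (hS : IsMoyalEquivalence n A x S) {r : ℕ} (α : Fin d)
    (f : SmoothOn x.image) :
    commCoord (S r) α f = (1 / 2 : ℂ) • ∑ l ∈ Icc 1 r,
      (A.term x l (coord α) (S (r - l) f) + A.term x l (S (r - l) f) (coord α)) := by
  have h1 := congrArg (PowerSeries.coeff r) (hS.map_prod (PowerSeries.C (coord α)) (PowerSeries.C f))
  have h2 := congrArg (PowerSeries.coeff r) (hS.map_prod (PowerSeries.C f) (PowerSeries.C (coord α)))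
  have hM : ∀ (g h : SmoothOn x.image) (b : ℕ),
      PowerSeries.coeff b (formalProd (moyalTerm n) (PowerSeries.C g) (PowerSeries.C h)) =
        moyalTerm n b g h := by
    intro g h b
    rw [coeff_formalProd_C_left _ fun k g => moyalTerm_zero_left n k g, sum_eq_single (b, 0)]
    · simp
    · rintro ⟨a, c⟩ hab hne
      have hc : c ≠ 0 := by
        rintro rfl
        exact hne (by simpa using hab)
      simp [PowerSeries.coeff_C, hc, moyalTerm_zero_right]
    · simp
  rw [hS.map_coord, coeff_formalProd_C_left _ fun k g => A.term_zero_left k g] at h1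
  rw [hS.map_coord, coeff_formalProd_C_right _ fun k g => A.term_zero_right k g] at h2
  simp only [formalMap, PowerSeries.coeff_mk, hM] at h1 h2
  have hSf : ∀ b, ∑ p ∈ antidiagonal b, S p.1 (PowerSeries.coeff p.2 (PowerSeries.C f)) = S b f :=
    fun b => by simpa [formalMap] using coeff_formalMap_C S f b
  simp only [hSf] at h1 h2
  have h3 := congrArg₂ (· + ·) h1 h2
  simp only [← sum_add_distrib, ← map_add] at h3
  -- On the Moyal side only order zero survives, giving `S_r` of twice `x^α f`. On the other side
  -- the `l = 0` term, twice `x^α S_r f`, is split off to form the commutator.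
  rw [sum_eq_single (r, 0), Nat.sum_antidiagonal_eq_sum_range_succ
    (fun l b => A.term x l (coord α) (S b f) + A.term x l (S b f) (coord α)),
    range_eq_Ico, sum_eq_sum_Ico_succ_bot (Nat.succ_pos r)] at h3
  · simp only [moyalTerm_order_zero, A.term_zero, mul_comm f, mul_comm (S _ f), map_add,
      Nat.sub_zero] at h3
    have hI : Ico (0 + 1) (r + 1) = Icc 1 r := by ext; simp
    rw [hI] at h3
    rw [commCoord, eq_comm, one_div, inv_smul_eq_iff₀ two_ne_zero, two_smul]
    linear_combination -h3
  · rintro ⟨a, b⟩ hab hne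
    have hb : b ≠ 0 := by
      rintro rfl
      exact hne (by simpa using hab)
    simp [moyalTerm_coord_add (Nat.one_le_iff_ne_zero.2 hb)]
  · simp

open Finset in
-- From `1 ⋆_M 1 = 1` follows `S(1) ⋆ S(1) = S(1)`. If the intermediate coefficients already vanish,
-- order `r` reads `S_r(1) = 2 S_r(1)`.
theorem IsMoyalEquivalence.apply_one (hS : IsMoyalEquivalence n A x S) {r : ℕ} (hr : 1 ≤ r) :
    S r 1 = 0 := by
  induction r using Nat.strong_induction_on with
  | _ r ih =>
  have h := congrArg (PowerSeries.coeff r) (hS.map_prod (PowerSeries.C 1) (PowerSeries.C 1))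
  have hM : formalProd (moyalTerm n) (PowerSeries.C (1 : SmoothOn x.image)) (PowerSeries.C 1) =
      PowerSeries.C 1 := by
    ext1 b
    rw [coeff_formalProd_C_left _ fun k g => moyalTerm_zero_left n k g, sum_eq_single (0, b)]
    · simp [moyalTerm_order_zero]
    · rintro ⟨a, c⟩ hab hne
      have ha : 1 ≤ a := by
        rw [Nat.one_le_iff_ne_zero]
        rintro rfl
        exact hne (by simpa using hab)
      by_cases hc : c = 0
      · simp [hc, moyalTerm_one_one ha]
      · simp [hc, moyalTerm_zero_right]
    · simp
  rw [hM, coeff_formalMap_C, formalProd, PowerSeries.coeff_mk] at h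
  simp only [coeff_formalMap_C] at h
  -- Only `C_0` contributes. For `l ≥ 1` the arguments have order below `r`, so by induction they
  -- are zero unless both are `1`, and `C_l(1, 1) = 0`.
  rw [sum_eq_single (0, r)] at h
  · have hne : ((0, r) : ℕ × ℕ) ≠ (r, 0) := by simp; omega
    -- The two extreme terms are distinct because `r ≥ 1`, and each equals `S_r(1)`; the others
    -- vanish by induction.
    rw [sum_eq_add (0, r) (r, 0) hne] at h
    · simpa [A.term_zero, hS.zero] using h
    · rintro ⟨a, b⟩ hab ⟨h1, h2⟩
      rw [HasAntidiagonal.mem_antidiagonal] at hab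
      have ha : a ≠ 0 := by rintro rfl; simp_all
      have hb : b ≠ 0 := by rintro rfl; simp_all
      simp [ih a (by omega) (by omega), A.term_zero_left]
    · simp
    · simp
  · rintro ⟨l, c⟩ hlc hne
    rw [HasAntidiagonal.mem_antidiagonal] at hlc
    have hl : 1 ≤ l := by
      rw [Nat.one_le_iff_ne_zero]
      rintro rfl
      simp_all
    refine sum_eq_zero ?_
    rintro ⟨a, b⟩ hab
    rw [HasAntidiagonal.mem_antidiagonal] at hab
    rcases Nat.eq_zero_or_pos a with rfl | ha
    · rcases Nat.eq_zero_or_pos b with rfl | hb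
      · simp [hS.zero, A.term_one_one x hl]
      · simp [ih b (by omega) hb, A.term_zero_right]
    · simp [ih a (by omega) ha, A.term_zero_left]
  · simp

open Finset in
theorem sum_Icc_eq_sum_even {E : Type*} [AddCommMonoid E] (F : ℕ → E)
    (hF : ∀ l, Odd l → F l = 0) {r m : ℕ} (hm : r = 2 * m ∨ r = 2 * m + 1) :
    ∑ l ∈ Icc 1 r, F l = ∑ l ∈ Icc 1 m, F (2 * l) := by
  symm
  refine sum_of_injOn (2 * ·) (by intro a _ b _ h; simpa using h) ?_ ?_ (fun _ _ => rfl)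
  · intro l hl
    simp only [coe_Icc, Set.mem_Icc] at hl ⊢
    omega
  · intro l hl hn
    refine hF l (Nat.not_even_iff_odd.1 fun he => hn ?_)
    obtain ⟨j, rfl⟩ := he
    simp only [mem_Icc] at hl
    exact ⟨j, by simp; omega, by simp; omega⟩

open Finset in
-- Parity cancels the two summands for odd `l` and makes them equal for even `l`. Taking `m` as the
-- integer part of `r / 2` treats both parities of `r` together.
theorem IsMoyalEquivalence.commCoord_eq_of_parity (hA : A.Parity) (hS : IsMoyalEquivalence n A x S)
    {r m : ℕ} (hm : r = 2 * m ∨ r = 2 * m + 1) (α : Fin d) (f : SmoothOn x.image) :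
    commCoord (S r) α f = ∑ l ∈ Icc 1 m, A.term x (2 * l) (coord α) (S (r - 2 * l) f) := by
  rw [hS.commCoord_eq, sum_Icc_eq_sum_even _ _ hm, smul_sum]
  · refine sum_congr rfl fun l _ => ?_
    rw [hA.term x (2 * l) (S _ f), pow_mul, neg_one_sq, one_pow, one_smul, ← two_smul ℂ, smul_smul]
    norm_num
  · intro l hl
    rw [hA.term x l (S _ f), hl.neg_one_pow, neg_one_smul, add_neg_cancel]

/-- Lowering an odd index by `2l` leaves it odd, so by induction all commutators with coordinates
vanish. What remains is multiplication by `S_{2r+1}(1) = 0`. -/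
theorem IsMoyalEquivalence.odd_eq_zero (hA : A.Parity) (hS : IsMoyalEquivalence n A x S) (r : ℕ) :
    S (2 * r + 1) = 0 := by
  induction r using Nat.strong_induction_on with
  | _ r ih =>
  ext1 f
  rw [(hS.diffOp _).eq_mul_of_commCoord_eq_zero _ f, hS.apply_one (by omega), zero_mul]
  · rfl
  intro α f
  rw [hS.commCoord_eq_of_parity hA (Or.inr rfl)]
  refine Finset.sum_eq_zero fun l hl => ?_
  rw [Finset.mem_Icc] at hl
  rw [show 2 * r + 1 - 2 * l = 2 * (r - l) + 1 by omega, ih (r - l) (by omega)]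
  exact A.term_zero_right _ _

end Equivalence

end DeformQuant

end

/-! ### The main theorem. -/

open scoped Manifold ContDiff
open DeformQuant
theorem mainTheorem2 {d n k : ℕ} (_hd : d = 2 * n + k)
    {M : Type*} [TopologicalSpace M] [T2Space M]
    [ChartedSpace (EuclideanSpace ℝ (Fin d)) M]
    [IsManifold 𝓘(ℝ, EuclideanSpace ℝ (Fin d)) ∞ M]
    (P : PoissonStructure (d := d) M) (A : StarProduct P) (hA : A.Parity)
    (x : Coordinates (d := d) M) (hc : ClassicalCanonical n P x) (hq : QuantumCanonical n A x)
    (S : ℕ → SmoothOn x.image →ₗ[ℂ] SmoothOn x.image) (hS : IsMoyalEquivalence n A x S) :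
    -- the general recurrence relations
    (∀ r, 1 ≤ r → ∀ (α : Fin d) (f : SmoothOn x.image),
      commCoord (S r) α f = (1 / 2 : ℂ) • ∑ l ∈ Finset.Icc 1 r,
        (A.term x l (coord α) (S (r - l) f) + A.term x l (S (r - l) f) (coord α))) ∧
    -- the form which they take under the parity condition
    (∀ (α : Fin d) (f : SmoothOn x.image), commCoord (S 1) α f = 0) ∧
    (∀ r, 1 ≤ r → ∀ (α : Fin d) (f : SmoothOn x.image),
      commCoord (S (2 * r + 1)) α f = ∑ l ∈ Finset.Icc 1 r,
        A.term x (2 * l) (coord α) (S (2 * (r - l) + 1) f)) ∧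
    (∀ r, 1 ≤ r → ∀ (α : Fin d) (f : SmoothOn x.image),
      commCoord (S (2 * r)) α f = ∑ l ∈ Finset.Icc 1 r,
        A.term x (2 * l) (coord α) (S (2 * (r - l)) f)) ∧
    -- the odd terms vanish
    (∀ r, S (2 * r + 1) = 0) ∧
    -- the even terms are the only normalized solution of their recurrence
    (∀ r, 1 ≤ r → S (2 * r) 1 = 0) ∧
    (∀ T : ℕ → SmoothOn x.image →ₗ[ℂ] SmoothOn x.image,
      T 0 = LinearMap.id → (∀ r, IsDiffOp (T r)) → (∀ r, 1 ≤ r → T r 1 = 0) →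
      (∀ r, 1 ≤ r → ∀ (α : Fin d) (f : SmoothOn x.image),
        commCoord (T r) α f = ∑ l ∈ Finset.Icc 1 r,
          A.term x (2 * l) (coord α) (T (r - l) f)) →
      ∀ r, T r = S (2 * r)) := by
  have hodd := hS.odd_eq_zero hA
  have heven : ∀ r, 1 ≤ r → ∀ (α : Fin d) (f : SmoothOn x.image),
      commCoord (S (2 * r)) α f = ∑ l ∈ Finset.Icc 1 r,
        A.term x (2 * l) (coord α) (S (2 * (r - l)) f) := fun r _ α f => by
    rw [hS.commCoord_eq_of_parity hA (Or.inl rfl)]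
    exact Finset.sum_congr rfl fun l _ => by rw [Nat.mul_sub]
  refine ⟨fun r _ α f => hS.commCoord_eq α f, fun α f => ?_, fun r _ α f => ?_, heven, hodd,
    fun r hr => hS.apply_one (by omega), fun T h0 hT h1 hrec r => ?_⟩
  -- With `m = 0` the sum over even orders is empty.
  · simpa using hS.commCoord_eq_of_parity hA (r := 1) (m := 0) (Or.inr rfl) α f
  · rw [hS.commCoord_eq_of_parity hA (Or.inr rfl)]
    refine Finset.sum_congr rfl fun l hl => ?_
    rw [Finset.mem_Icc] at hl
    rw [show 2 * r + 1 - 2 * l = 2 * (r - l) + 1 by omega]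
  · induction r using Nat.strong_induction_on with
    | _ r ih =>
    rcases Nat.eq_zero_or_pos r with rfl | hr
    · rw [h0, mul_zero, hS.zero]
    -- Both operators kill `1`, and their commutators are given by the same formula in terms of
    -- lower orders, where they agree by induction.
    · refine (hT r).eq_of_commCoord_eq (hS.diffOp _) (fun α f => ?_)
        ((h1 r hr).trans (hS.apply_one (by omega)).symm)
      rw [hrec r hr, heven r hr]
      refine Finset.sum_congr rfl fun l hl => ?_
      rw [Finset.mem_Icc] at hl
      rw [ih (r - l) (by omega)]
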